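/- A cubic algebra is a join semi-lattice $\mathcal L$ with greatest element $1$ and a binary operation $\Delta$ such that, for all $x,y,z$: (a) $x\le y$ implies $\Delta(y,x)\vee x=y$; (b) $x\le y\le z$ implies $\Delta(z,\Delta(y,x))=\Delta(\Delta(z,y),\Delta(z,x))$; (c) $x\le y$ implies $\Delta(y,\Delta(y,x))=x$; (d) $x\le y\le z$ implies $\Delta(z,x)\le\Delta(z,y)$; and, writing $x\to y=\Delta(1,\Delta(x\vee y,y))\vee y$, (e) $(x\to y)\to y=x\vee y$ and (f) $x\to(y\to z)=y\to(x\to z)$. An MR-algebra is a cubic algebra such that whenever $a,b<x$, one has $\Delta(x,a)\vee b<x$ if and only if the meet $a\wedge b$ does not exist. In a cubic algebra put $$a\simeq b\iff\Delta(a\vee b,a)=b,\qquad a*b=a\vee\Delta(a\vee b,b),\qquad a\Rightarrow b=\Delta(a\vee b,a)\to b,$$ and let $a\mathbin{\hat{\ }}b=a\wedge\Delta(a\vee b,b)$ whenever this meet exists. An implication lattice is a lattice with a greatest element and a binary operation $\to$ satisfying $(p\to q)\to p=p$, $(p\to q)\to q=p\vee q$ and $p\to(q\to r)=q\to(p\to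 r)$. **Theorem.** Let $\mathcal L$ be an MR-algebra. Then $\simeq$ is an equivalence relation on $\mathcal L$, the meet $a\mathbin{\hat{\ }}b$ exists for all $a,b\in\mathcal L$, and $\mathcal L/{\simeq}$ is an implication lattice whose greatest element and operations are well defined by $$1=[1],\qquad [a]\vee[b]=[a*b],\qquad [a]\to[b]=[a\Rightarrow b],\qquad [a]\wedge[b]=[a\mathbin{\hat{\ }}b].$$ -/

import Mathlib

/-- `x y := Δ(1, Δ(x ∨ y, y)) ∨ y` for a binary operation `Δ`, where `D y x` is `Δ(y, x)`. -/
def cubicArrow {L : Type*} [SemilatticeSup L] [OrderTop L] (D : L → L → L) (x y : L) : L :=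
  D ⊤ (D (x ⊔ y) y) ⊔ y

/-- A cubic algebra: a join semi-lattice with a greatest element (written `⊤`, the `1` of the
algebra) and a binary operation `delta`, where `delta y x` is `Δ(y, x)`. -/
class CubicAlgebra (L : Type*) extends SemilatticeSup L, OrderTop L where
  delta : L → L → L
  delta_sup : ∀ x y : L, x ≤ y → delta y x ⊔ x = y
  delta_delta_delta : ∀ x y z : L, x ≤ y → y ≤ z →
    delta z (delta y x) = delta (delta z y) (delta z x)
  delta_delta : ∀ x y : L, x ≤ y → delta y (delta y x) = x
  delta_mono : ∀ x y z : L, x ≤ y → y ≤ z → delta z x ≤ delta z y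
  arrow_arrow : ∀ x y : L, cubicArrow delta (cubicArrow delta x y) y = x ⊔ y
  arrow_left_comm : ∀ x y z : L,
    cubicArrow delta x (cubicArrow delta y z) = cubicArrow delta y (cubicArrow delta x z)

/-- An MR-algebra: a cubic algebra in which, for `a, b < x`, one has `Δ(x, a) ∨ b < x` if and only
if `a` and `b` have no meet. -/
class MRAlgebra (L : Type*) extends CubicAlgebra L where
  mr : ∀ x a b : L, a < x → b < x → (delta x a ⊔ b < x ↔ ¬ ∃ m : L, IsGLB {a, b} m)

namespace CubicAlgebra

/-- `a ≃ b` iff `Δ(a ∨ b, a) = b`. -/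
def Simeq {L : Type*} [CubicAlgebra L] (a b : L) : Prop := delta (a ⊔ b) a = b

/-- `x → y = Δ(1, Δ(x ∨ y, y)) ∨ y`. -/
def arrow {L : Type*} [CubicAlgebra L] (x y : L) : L := cubicArrow delta x y

/-- `a * b = a ∨ Δ(a ∨ b, b)`. -/
def star {L : Type*} [CubicAlgebra L] (a b : L) : L := a ⊔ delta (a ⊔ b) b

/-- `a ⇒ b = Δ(a ∨ b, a) → b`. -/
def imp {L : Type*} [CubicAlgebra L] (a b : L) : L := arrow (delta (a ⊔ b) a) b

/-- `IsCaret a b c`: the meet `a ∧ Δ(a ∨ b, b)` exists and equals `c`. As meets are unique, this is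
the graph of the partial operation caret. -/
def IsCaret {L : Type*} [CubicAlgebra L] (a b c : L) : Prop := IsGLB {a, delta (a ⊔ b) b} c

/-- The quotient `L/≃`, given that `≃` is an equivalence relation. -/
def Collapse {L : Type*} [CubicAlgebra L] (h : Equivalence (Simeq : L → L → Prop)) : Type _ :=
  Quotient (Setoid.mk Simeq h)

/-- The class `[a]` of `a` in `L/≃`. -/
def cls {L : Type*} [CubicAlgebra L] (h : Equivalence (Simeq : L → L → Prop)) (a : L) :
    Collapse h :=
  Quotient.mk (Setoid.mk Simeq h) a

end CubicAlgebra

/-- An implication lattice: a lattice with a greatest element and an operation `⇨` that satisfies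
the axioms of an implication algebra and whose induced join `(a ⇨ b) ⇨ b` is the join of the
lattice (so the lattice order is the one of the implication algebra, and
`(a ⇨ b) ⇨ b = (b ⇨ a) ⇨ a`). -/
class ImplicationLattice (P : Type*) extends Lattice P, OrderTop P, HImp P where
  himp_contraction : ∀ a b : P, (a ⇨ b) ⇨ a = a
  himp_himp_eq_sup : ∀ a b : P, (a ⇨ b) ⇨ b = a ⊔ b
  himp_exchange : ∀ a b c : P, a ⇨ (b ⇨ c) = b ⇨ (a ⇨ c)

/-! Every upper interval `[p, ⊤]` is Boolean under `arrow`, and the quotient borrows this structure.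
Call `a` below `b` if `a` lies under some reflection of `b`. Then `Simeq` is this relation in both
directions (`simeq_iff`), so everything rests on its transitivity, `Below.trans`. That follows from
`delta_delta_eq_of_compl`: composing two reflections amounts to one reflection in a relative
complement.

The MR axiom enters only through `exists_isCaret`. It lets any class be represented by an element
sharing a lower bound with a given one, and between such elements `Below` is just `≤` (`Below.le`).
Joins, meets and implications of classes are thus computed inside upper intervals, where the
implication identities already hold. -/

namespace CubicAlgebra

/-! ### Implication calculus: upper intervals are Boolean. -/

section Arrow

variable {L : Type*} [CubicAlgebra L] {a b c e g h m n p q u v w x y z : L}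

theorem delta_le (h : x ≤ y) : delta y x ≤ y :=
  le_sup_left.trans_eq (delta_sup x y h)

theorem delta_self (y : L) : delta y y = y := by
  refine le_antisymm (delta_le le_rfl) ?_
  have h := delta_mono (delta y y) y y (delta_le le_rfl) le_rfl
  rwa [delta_delta y y le_rfl] at h

theorem delta_le_comm (hx : x ≤ z) (hy : y ≤ z) (h : delta z x ≤ y) : x ≤ delta z y := by
  have := delta_mono _ _ _ h hy
  rwa [delta_delta x z hx] at this

theorem le_delta_comm (hy : y ≤ z) (h : x ≤ delta z y) : delta z x ≤ y := by
  have := delta_mono _ _ _ h (delta_le hy)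
  rwa [delta_delta y z hy] at this

theorem delta_sup_distrib (hx : x ≤ z) (hy : y ≤ z) :
    delta z (x ⊔ y) = delta z x ⊔ delta z y := by
  refine le_antisymm ?_ (sup_le (delta_mono _ _ _ le_sup_left (sup_le hx hy))
    (delta_mono _ _ _ le_sup_right (sup_le hx hy)))
  refine le_delta_comm (sup_le (delta_le hx) (delta_le hy)) (sup_le ?_ ?_)
  · exact delta_le_comm hx (sup_le (delta_le hx) (delta_le hy)) le_sup_left
  · exact delta_le_comm hy (sup_le (delta_le hx) (delta_le hy)) le_sup_right

theorem arrow_def (x y : L) : arrow x y = delta ⊤ (delta (x ⊔ y) y) ⊔ y := rfl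

theorem arrow_of_ge (h : y ≤ x) : arrow x y = delta ⊤ (delta x y) ⊔ y := by
  rw [arrow_def, sup_eq_left.2 h]

theorem le_arrow (x y : L) : y ≤ arrow x y := le_sup_right

theorem arrow_arrow_eq_sup (x y : L) : arrow (arrow x y) y = x ⊔ y := arrow_arrow x y

theorem arrow_exchange (x y z : L) : arrow x (arrow y z) = arrow y (arrow x z) :=
  arrow_left_comm x y z

theorem top_arrow (x : L) : arrow ⊤ x = x := by
  rw [arrow_of_ge le_top, delta_delta x ⊤ le_top, sup_idem]

theorem arrow_eq_top_iff : arrow x y = ⊤ ↔ x ≤ y := by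
  constructor
  · intro h
    have := arrow_arrow_eq_sup x y
    rw [h, top_arrow] at this
    exact left_eq_sup.1 (this.trans (sup_comm x y))
  · intro h
    rw [arrow_def, sup_eq_right.2 h, delta_self, delta_sup y ⊤ le_top]

theorem arrow_sup_self (x y : L) : arrow x y ⊔ x = ⊤ := by
  refine top_le_iff.1 ?_
  rw [← delta_sup (delta (x ⊔ y) y) ⊤ le_top]
  refine sup_le (le_sup_left.trans le_sup_left) ?_
  refine (delta_le le_sup_right).trans (sup_le le_sup_right ?_)
  exact (le_arrow x y).trans le_sup_left

theorem arrow_contraction (x y : L) : arrow (arrow x y) x = x := by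
  rw [arrow_def, arrow_sup_self, delta_delta x ⊤ le_top, sup_idem]

theorem arrow_arrow_self (x y : L) : arrow x (arrow x y) = arrow x y := by
  have h := arrow_contraction (arrow x y) x
  rwa [arrow_contraction x y] at h

theorem le_arrow_comm : x ≤ arrow y z ↔ y ≤ arrow x z := by
  rw [← arrow_eq_top_iff, arrow_exchange, arrow_eq_top_iff]

theorem le_of_le_arrow (h : x ≤ u) (h' : x ≤ arrow u y) : x ≤ y := by
  have := h.trans (le_arrow_comm.1 h')
  rwa [← arrow_eq_top_iff, arrow_arrow_self, arrow_eq_top_iff] at this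

theorem arrow_mono_right (a : L) (h : b ≤ c) : arrow a b ≤ arrow a c := by
  have : arrow a c = arrow (arrow c b) (arrow a b) := by
    rw [arrow_exchange, arrow_arrow_eq_sup, sup_eq_left.2 h]
  rw [this]
  exact le_arrow _ _

theorem arrow_anti_left (c : L) (h : a ≤ b) : arrow b c ≤ arrow a c := by
  rw [le_arrow_comm, arrow_arrow_eq_sup]
  exact h.trans le_sup_left

theorem le_of_le_sup_of_le_arrow (h : v ≤ u ⊔ w) (h' : v ≤ arrow u e) (he : e ≤ w) : v ≤ w := by
  have h1 : u ≤ arrow v w := (le_arrow_comm.1 h').trans (arrow_mono_right v he)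
  have h2 : v ≤ arrow v w := h.trans (sup_le h1 (le_arrow v w))
  exact le_of_le_arrow le_rfl h2

/-- De Morgan over the bottom `p`: the meet is the negation of `a → ¬b`. -/
theorem isGLB_arrow (ha : p ≤ a) (hb : p ≤ b) :
    IsGLB {a, b} (arrow (arrow a (arrow b p)) p) := by
  constructor
  · rintro y (rfl | rfl)
    · have := arrow_anti_left p (arrow_mono_right y (le_arrow b p))
      rwa [arrow_arrow_eq_sup y p, sup_eq_left.2 ha] at this
    · have := arrow_anti_left p (le_arrow a (arrow y p))
      rwa [arrow_arrow_eq_sup y p, sup_eq_left.2 hb] at this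
  · intro q hq
    have hqa : q ≤ a := hq (by simp)
    have hqb : q ≤ b := hq (by simp)
    rw [le_arrow_comm]
    calc arrow a (arrow b p) ≤ arrow q (arrow b p) := arrow_anti_left _ hqa
      _ = arrow b (arrow q p) := arrow_exchange _ _ _
      _ ≤ arrow q (arrow q p) := arrow_anti_left _ hqb
      _ = arrow q p := arrow_arrow_self _ _

theorem exists_isGLB (ha : p ≤ a) (hb : p ≤ b) : ∃ m, IsGLB {a, b} m ∧ p ≤ m :=
  ⟨_, isGLB_arrow ha hb, le_arrow _ _⟩

theorem le_arrow_iff_of_isGLB (hm : IsGLB {g, a} m) : g ≤ arrow a b ↔ m ≤ b := by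
  have hg : m ≤ g := hm.1 (by simp)
  have ha : m ≤ a := hm.1 (by simp)
  refine ⟨fun h => le_of_le_arrow ha (hg.trans h), fun h => ?_⟩
  have key := hm.unique (isGLB_arrow hg ha)
  have ht : arrow g (arrow a m) = ⊤ := by
    have hmt : m ≤ arrow g (arrow a m) := (le_arrow a m).trans (le_arrow g _)
    have := arrow_arrow_eq_sup (arrow g (arrow a m)) m
    rwa [← key, arrow_eq_top_iff.2 le_rfl, sup_eq_left.2 hmt, eq_comm] at this
  exact (arrow_eq_top_iff.1 ht).trans (arrow_mono_right a h)

end Arrow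

/-! ### Composition of reflections and the relation `≃`. -/

section Reflection

variable {L : Type*} [CubicAlgebra L] {a b c d e g h m n p q u v w x y z : L}

/-- `hC` is isolated for a bootstrap: it is immediate for `z = ⊤` from the definition of `arrow`,
and that case then yields it for every `z`. -/
theorem delta_delta_eq_of_forall
    (hC : ∀ e u : L, e ≤ u → u ≤ z → delta z (delta u e) ≤ arrow u e)
    (hu : e ≤ u) (hw : e ≤ w) (hz : u ⊔ w = z) (hd : u ≤ arrow w e) :
    delta z (delta w e) = delta u e := by
  have key : ∀ u w : L, e ≤ u → e ≤ w → u ⊔ w = z → u ≤ arrow w e →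
      delta z (delta u e) ≤ w := by
    intro u w hu hw hz hd
    have huz : u ≤ z := le_sup_left.trans_eq hz
    refine le_of_le_sup_of_le_arrow ?_ (hC e u hu huz) hw
    exact (delta_le ((delta_le hu).trans huz)).trans_eq hz.symm
  have main : ∀ u w : L, e ≤ u → e ≤ w → u ⊔ w = z → u ≤ arrow w e →
      delta z (delta w e) ≤ delta u e := by
    intro u w hu hw hz hd
    have huz : u ≤ z := le_sup_left.trans_eq hz
    have hwz : w ≤ z := le_sup_right.trans_eq hz
    have hwez : delta w e ≤ z := (delta_le hw).trans hwz
    have huez : delta u e ≤ z := (delta_le hu).trans huz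
    -- The element is under `u`, so by modus ponens a bound by `u → Δ(u, e)` suffices.
    refine le_of_le_arrow (key w u hw hu (by rw [sup_comm, hz]) (le_arrow_comm.1 hd)) ?_
    have hweq : w ≤ delta z (delta u e) ⊔ e := by
      refine le_of_le_sup_of_le_arrow (u := u) (e := e) ?_ (le_arrow_comm.1 hd) le_sup_right
      have h1 : z ≤ u ⊔ delta z (delta u e) := by
        conv_lhs => rw [← delta_sup _ z huez]
        exact sup_le le_sup_right ((delta_le hu).trans le_sup_left)
      exact hwz.trans (h1.trans (sup_le_sup_left le_sup_left _))
    have h2 : delta z (delta w e) ≤ delta u e ⊔ delta z e := by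
      have h3 := delta_mono _ _ z ((delta_le hw).trans hweq)
        (sup_le (delta_le huez) (hu.trans huz))
      rwa [delta_sup_distrib (delta_le huez) (hu.trans huz), delta_delta _ z huez] at h3
    refine h2.trans (sup_le (le_arrow _ _) ?_)
    have h4 := hC (delta u e) u (delta_le hu) huz
    rwa [delta_delta e u hu] at h4
  refine le_antisymm (main u w hu hw hz hd) ?_
  have huz : u ≤ z := le_sup_left.trans_eq hz
  have hwz : w ≤ z := le_sup_right.trans_eq hz
  exact delta_le_comm ((delta_le hu).trans huz) ((delta_le hw).trans hwz)
    (main w u hw hu (by rw [sup_comm, hz]) (le_arrow_comm.1 hd))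

theorem delta_top_delta_arrow (hu : e ≤ u) : delta ⊤ (delta (arrow u e) e) = delta u e := by
  refine delta_delta_eq_of_forall (fun e u he _ => ?_) hu (le_arrow u e) ?_ ?_
  · rw [arrow_of_ge he]
    exact le_sup_left
  · rw [sup_comm, arrow_sup_self]
  · rw [arrow_arrow_eq_sup]
    exact le_sup_left

theorem delta_delta_le_arrow (hu : e ≤ u) (hz : u ≤ z) : delta z (delta u e) ≤ arrow u e := by
  obtain ⟨d, hd, rfl⟩ : ∃ d, d ≤ u ∧ e = delta u d :=
    -- Over `d = Δ(u, e)`, both sides become images under `Δ(⊤, ·)`, and the claim reduces to `z → d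
    -- ≤ u → d`.
    ⟨delta u e, delta_le hu, (delta_delta e u hu).symm⟩
  rw [delta_delta d u hd, arrow_of_ge (delta_le hd), delta_delta d u hd,
    ← delta_top_delta_arrow hd, ← delta_top_delta_arrow (hd.trans hz),
    ← delta_sup_distrib le_top le_top, sup_comm, delta_sup _ _ (le_arrow u d)]
  exact delta_mono _ _ _ ((delta_le (le_arrow z d)).trans (arrow_anti_left d hz)) le_top

/-- Reflecting `e` in `w` and then in `z` is reflecting `e` in the complement of `w` in `[e, z]`. -/
theorem delta_delta_eq_of_compl (hu : e ≤ u) (hw : e ≤ w) (hz : u ⊔ w = z) (hd : u ≤ arrow w e) :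
    delta z (delta w e) = delta u e :=
  delta_delta_eq_of_forall (fun _ _ he hu => delta_delta_le_arrow he hu) hu hw hz hd

theorem exists_compl (hu : e ≤ u) (hz : u ≤ z) : ∃ w, e ≤ w ∧ w ⊔ u = z ∧ w ≤ arrow u e := by
  have huez : delta u e ≤ z := (delta_le hu).trans hz
  refine ⟨delta z (delta u e) ⊔ e, le_sup_right, le_antisymm ?_ ?_,
    sup_le (delta_delta_le_arrow hu hz) (le_arrow u e)⟩
  · exact sup_le (sup_le (delta_le huez) (hu.trans hz)) hz
  · conv_lhs => rw [← delta_sup _ z huez]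
    exact sup_le (le_sup_left.trans le_sup_left) ((delta_le hu).trans le_sup_right)

theorem delta_le_delta_sup_of_isGLB (hm : IsGLB {x, e} m) : delta x m ≤ delta (x ⊔ e) e := by
  have hx : m ≤ x := hm.1 (by simp)
  have he : m ≤ e := hm.1 (by simp)
  rw [← delta_delta_eq_of_compl hx he rfl ((le_arrow_iff_of_isGLB hm).2 le_rfl)]
  exact delta_mono _ _ _ (delta_le he) le_sup_right

/-- Any two reflections of an element are reflections of each other. -/
theorem exists_delta_delta_eq (hu : e ≤ u) (hy : e ≤ y) :
    ∃ z, delta u e ≤ z ∧ delta z (delta u e) = delta y e := by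
  obtain ⟨m, hm, hem⟩ := exists_isGLB hu hy
  have hmu : m ≤ u := hm.1 (by simp)
  have hmy : m ≤ y := hm.1 (by simp)
  have hdm : delta m e ≤ m := delta_le hem
  obtain ⟨v, hv, hvu, hva⟩ := exists_compl hdm hmu
  obtain ⟨w, hw, hwy, hwa⟩ := exists_compl hdm hmy
  have h1 := delta_delta_eq_of_compl hv hdm hvu hva
  have h2 := delta_delta_eq_of_compl hw hdm hwy hwa
  rw [delta_delta e m hem] at h1 h2
  obtain ⟨n, hn, -⟩ := exists_isGLB hw hv
  have hnw : n ≤ w := hn.1 (by simp)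
  have hnv : n ≤ v := hn.1 (by simp)
  have hnm : n ≤ m := by
    refine hm.2 ?_
    rintro t (rfl | rfl)
    · exact hnv.trans (le_sup_left.trans_eq hvu)
    · exact hnw.trans (le_sup_left.trans_eq hwy)
  -- Both reflections of `e` are now reflections of `Δ(m, e)`, in `v` and in `w`; this bound makes
  -- `v` and `w` complementary over it in `w ⊔ v`.
  have hne : n ≤ delta m e := le_of_le_arrow hnm (hnv.trans hva)
  refine ⟨w ⊔ v, ?_, ?_⟩
  · rw [h1]
    exact (delta_le hv).trans le_sup_right
  · rw [h1, h2]
    exact delta_delta_eq_of_compl hw hv rfl ((le_arrow_iff_of_isGLB hn).2 hne)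

/-- `a` lies below a reflection of `b`. -/
def Below (a b : L) : Prop := ∃ x, b ≤ x ∧ a ≤ delta x b

theorem below_of_le (h : a ≤ b) : Below a b := ⟨b, le_rfl, by rwa [delta_self]⟩

theorem eq_sup_of_le_delta (hx : b ≤ x) (h : a ≤ delta x b) : x = a ⊔ b := by
  have hax : a ≤ x := h.trans (delta_le hx)
  refine le_antisymm ?_ (sup_le hax hx)
  rw [← delta_sup a x hax, sup_comm]
  exact sup_le_sup_left (le_delta_comm hx h) a

theorem below_delta (h : a ≤ x) : Below a (delta x a) :=
  ⟨x, delta_le h, (delta_delta a x h).ge⟩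

theorem delta_below (h : a ≤ x) : Below (delta x a) a := ⟨x, h, le_rfl⟩

/-- Enlarging `b` to `x ∧ Δ(y, c)` puts `a` under a reflection of `Δ(y, c)`; since `c` is another
one, the two are reflections of each other. -/
theorem Below.trans (hab : Below a b) (hbc : Below b c) : Below a c := by
  obtain ⟨x, hbx, hax⟩ := hab
  obtain ⟨y, hcy, hby⟩ := hbc
  obtain ⟨m, hm, hbm⟩ := exists_isGLB hbx hby
  have hmx : m ≤ x := hm.1 (by simp)
  have h1 : a ≤ delta (x ⊔ delta y c) (delta y c) :=
    hax.trans ((delta_mono _ _ _ hbm hmx).trans (delta_le_delta_sup_of_isGLB hm))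
  obtain ⟨z, hz, hzc⟩ := exists_delta_delta_eq (u := y) (y := x ⊔ delta y c)
    (delta_le hcy) le_sup_right
  rw [delta_delta c y hcy] at hz hzc
  exact ⟨z, hz, hzc ▸ h1⟩

theorem simeq_iff : Simeq a b ↔ Below a b ∧ Below b a := by
  constructor
  · intro h
    refine ⟨⟨a ⊔ b, le_sup_right, ?_⟩, ⟨a ⊔ b, le_sup_left, h.ge⟩⟩
    have h' : delta (a ⊔ b) a = b := h
    have := delta_delta a (a ⊔ b) le_sup_left
    rw [h'] at this
    exact this.ge
  · rintro ⟨⟨x, hbx, hax⟩, ⟨y, hay, hby⟩⟩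
    obtain rfl := eq_sup_of_le_delta hbx hax
    obtain rfl := eq_sup_of_le_delta hay hby
    rw [sup_comm] at hby
    exact le_antisymm (le_delta_comm le_sup_right hax) hby

theorem simeq_equivalence : Equivalence (Simeq : L → L → Prop) where
  refl _ := simeq_iff.2 ⟨below_of_le le_rfl, below_of_le le_rfl⟩
  symm h := simeq_iff.2 (simeq_iff.1 h).symm
  trans h h' := simeq_iff.2 ⟨(simeq_iff.1 h).1.trans (simeq_iff.1 h').1,
    (simeq_iff.1 h').2.trans (simeq_iff.1 h).2⟩

theorem simeq_delta (h : a ≤ x) : Simeq a (delta x a) :=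
  simeq_iff.2 ⟨below_delta h, delta_below h⟩

/-- Both `p` and `Δ(x, p)` lie under `c`, and their join is `x`, so `a ≤ x ≤ c`. -/
theorem Below.le (h : Below a c) (ha : p ≤ a) (hc : p ≤ c) : a ≤ c := by
  obtain ⟨x, hcx, hax⟩ := h
  have hpx : p ≤ x := hc.trans hcx
  refine (hax.trans (delta_le hcx)).trans ?_
  rw [← delta_sup p x hpx]
  exact sup_le (le_delta_comm hcx (ha.trans hax)) hc

end Reflection

end CubicAlgebra

/-! ### The quotient of an MR-algebra as an implication lattice. -/

namespace MRAlgebra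

open CubicAlgebra

variable {L : Type*} [MRAlgebra L] {a b c g m p : L}

theorem exists_isCaret (a b : L) : ∃ c, IsCaret a b c := by
  have hb : b ≤ a ⊔ b := le_sup_right
  have hd : delta (a ⊔ b) b ≤ a ⊔ b := delta_le hb
  rcases (le_sup_left : a ≤ a ⊔ b).eq_or_lt with ha | ha
  · exact ⟨_, isGLB_arrow (ha ▸ hd) le_rfl⟩
  rcases hd.eq_or_lt with h | h
  · exact ⟨_, isGLB_arrow le_rfl (h.ge.trans' le_sup_left)⟩
  · by_contra hn
    -- Reflecting `Δ(a ⊔ b, b)` gives back `b`, so a missing meet would force `b ⊔ a < a ⊔ b`.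
    have := (mr _ _ _ h ha).2 (by rwa [Set.pair_comm])
    rw [delta_delta b _ hb, sup_comm] at this
    exact this.false

theorem exists_simeq_le (a p : L) : ∃ b q : L, Simeq a b ∧ q ≤ b ∧ q ≤ p := by
  obtain ⟨c, hc⟩ := exists_isCaret p a
  exact ⟨_, c, simeq_delta (le_sup_right : a ≤ p ⊔ a), hc.1 (by simp), hc.1 (by simp)⟩

theorem exists_simeq_of_below (h : Below p c) : ∃ d, Simeq c d ∧ p ≤ d :=
  let ⟨_, hx, hp⟩ := h
  ⟨_, simeq_delta hx, hp⟩

theorem sup_below (ha : p ≤ a) (hb : p ≤ b) (hac : Below a c) (hbc : Below b c) :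
    Below (a ⊔ b) c := by
  obtain ⟨d, hcd, hpd⟩ := exists_simeq_of_below ((below_of_le ha).trans hac)
  rw [simeq_iff] at hcd
  exact (below_of_le (sup_le ((hac.trans hcd.1).le ha hpd) ((hbc.trans hcd.1).le hb hpd))).trans
    hcd.2

/-- A representative of `g` sharing a lower bound with `m` shares it with `a` and `b`, so `Below`
becomes `≤`. -/
theorem below_of_isGLB (hm : IsGLB {a, b} m) (ha : Below g a) (hb : Below g b) : Below g m := by
  obtain ⟨d, q, hgd, hqd, hqm⟩ := exists_simeq_le g m
  rw [simeq_iff] at hgd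
  refine hgd.1.trans (below_of_le (hm.2 ?_))
  rintro t (rfl | rfl)
  · exact (hgd.2.trans ha).le hqd (hqm.trans (hm.1 (by simp)))
  · exact (hgd.2.trans hb).le hqd (hqm.trans (hm.1 (by simp)))

/-- The quotient of an MR-algebra by `≃`. -/
def Quo (L : Type*) [MRAlgebra L] : Type _ := Collapse (simeq_equivalence (L := L))

/-- The class of an element in the quotient by `≃`. -/
def toQuo (a : L) : Quo L := cls simeq_equivalence a

theorem toQuo_eq_iff : toQuo a = toQuo b ↔ Simeq a b :=
  ⟨fun h => Quotient.exact h, fun h => Quotient.sound h⟩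

theorem toQuo_surjective (α : Quo L) : ∃ a, toQuo a = α := Quotient.exists_rep α

instance : PartialOrder (Quo L) where
  le α β := ∃ a b, toQuo a = α ∧ toQuo b = β ∧ Below a b
  le_refl α := by
    obtain ⟨a, rfl⟩ := toQuo_surjective α
    exact ⟨a, a, rfl, rfl, below_of_le le_rfl⟩
  le_trans := by
    rintro _ _ _ ⟨a, b, rfl, rfl, hab⟩ ⟨b', c, hb, rfl, hbc⟩
    rw [toQuo_eq_iff, simeq_iff] at hb
    exact ⟨a, c, rfl, rfl, hab.trans (hb.2.trans hbc)⟩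
  le_antisymm := by
    rintro _ _ ⟨a, b, rfl, rfl, hab⟩ ⟨b', a', hb, ha, hba⟩
    rw [toQuo_eq_iff, simeq_iff] at hb ha
    exact toQuo_eq_iff.2 (simeq_iff.2 ⟨hab, hb.2.trans (hba.trans ha.1)⟩)

theorem toQuo_le_toQuo : toQuo a ≤ toQuo b ↔ Below a b := by
  constructor
  · rintro ⟨a', b', ha, hb, h⟩
    rw [toQuo_eq_iff, simeq_iff] at ha hb
    exact ha.2.trans (h.trans hb.1)
  · exact fun h => ⟨a, b, rfl, rfl, h⟩

theorem toQuo_delta_sup (a b : L) : toQuo (delta (a ⊔ b) b) = toQuo b :=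
  (toQuo_eq_iff.2 (simeq_delta le_sup_right)).symm

theorem toQuo_delta_sup' (a b : L) : toQuo (delta (a ⊔ b) a) = toQuo a :=
  (toQuo_eq_iff.2 (simeq_delta le_sup_left)).symm

theorem isLUB_toQuo_sup (ha : p ≤ a) (hb : p ≤ b) : IsLUB {toQuo a, toQuo b} (toQuo (a ⊔ b)) := by
  constructor
  · rintro _ (rfl | rfl)
    exacts [toQuo_le_toQuo.2 (below_of_le le_sup_left), toQuo_le_toQuo.2 (below_of_le le_sup_right)]
  · intro γ hγ
    obtain ⟨c, rfl⟩ := toQuo_surjective γ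
    exact toQuo_le_toQuo.2 (sup_below ha hb
      (toQuo_le_toQuo.1 (hγ (by simp))) (toQuo_le_toQuo.1 (hγ (by simp))))

theorem isGLB_toQuo (hm : IsGLB {a, b} m) : IsGLB {toQuo a, toQuo b} (toQuo m) := by
  constructor
  · rintro _ (rfl | rfl)
    exacts [toQuo_le_toQuo.2 (below_of_le (hm.1 (by simp))),
      toQuo_le_toQuo.2 (below_of_le (hm.1 (by simp)))]
  · intro γ hγ
    obtain ⟨c, rfl⟩ := toQuo_surjective γ
    exact toQuo_le_toQuo.2 (below_of_isGLB hm
      (toQuo_le_toQuo.1 (hγ (by simp))) (toQuo_le_toQuo.1 (hγ (by simp))))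

theorem isLUB_toQuo_star (a b : L) : IsLUB {toQuo a, toQuo b} (toQuo (CubicAlgebra.star a b)) := by
  obtain ⟨c, hc⟩ := exists_isCaret a b
  -- The caret serves as the common lower bound of `a` and the reflected `b`.
  have := isLUB_toQuo_sup (hc.1 (Set.mem_insert a _)) (hc.1 (Set.mem_insert_of_mem a rfl))
  rwa [toQuo_delta_sup] at this

theorem isGLB_toQuo_of_isCaret (h : IsCaret a b c) : IsGLB {toQuo a, toQuo b} (toQuo c) := by
  have := isGLB_toQuo h
  rwa [toQuo_delta_sup] at this

noncomputable instance : Lattice (Quo L) where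
  sup α β := toQuo (CubicAlgebra.star (toQuo_surjective α).choose (toQuo_surjective β).choose)
  le_sup_left α β := by
    have := isLUB_toQuo_star (toQuo_surjective α).choose (toQuo_surjective β).choose
    rw [(toQuo_surjective α).choose_spec, (toQuo_surjective β).choose_spec] at this
    exact this.1 (by simp)
  le_sup_right α β := by
    have := isLUB_toQuo_star (toQuo_surjective α).choose (toQuo_surjective β).choose
    rw [(toQuo_surjective α).choose_spec, (toQuo_surjective β).choose_spec] at this
    exact this.1 (by simp)
  sup_le α β γ hα hβ := by
    have := isLUB_toQuo_star (toQuo_surjective α).choose (toQuo_surjective β).choose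
    rw [(toQuo_surjective α).choose_spec, (toQuo_surjective β).choose_spec] at this
    exact this.2 (by rintro _ (rfl | rfl) <;> assumption)
  inf α β := toQuo (exists_isCaret (toQuo_surjective α).choose (toQuo_surjective β).choose).choose
  inf_le_left α β := by
    have := isGLB_toQuo_of_isCaret
      (exists_isCaret (toQuo_surjective α).choose (toQuo_surjective β).choose).choose_spec
    rw [(toQuo_surjective α).choose_spec, (toQuo_surjective β).choose_spec] at this
    exact this.1 (by simp)
  inf_le_right α β := by
    have := isGLB_toQuo_of_isCaret
      (exists_isCaret (toQuo_surjective α).choose (toQuo_surjective β).choose).choose_spec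
    rw [(toQuo_surjective α).choose_spec, (toQuo_surjective β).choose_spec] at this
    exact this.1 (by simp)
  le_inf γ α β hα hβ := by
    have := isGLB_toQuo_of_isCaret
      (exists_isCaret (toQuo_surjective α).choose (toQuo_surjective β).choose).choose_spec
    rw [(toQuo_surjective α).choose_spec, (toQuo_surjective β).choose_spec] at this
    exact this.2 (by rintro _ (rfl | rfl) <;> assumption)

instance : OrderTop (Quo L) where
  top := toQuo ⊤
  le_top α := by
    obtain ⟨a, rfl⟩ := toQuo_surjective α
    exact toQuo_le_toQuo.2 (below_of_le le_top)

theorem toQuo_sup_toQuo (ha : p ≤ a) (hb : p ≤ b) : toQuo a ⊔ toQuo b = toQuo (a ⊔ b) :=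
  isLUB_pair.unique (isLUB_toQuo_sup ha hb)

theorem toQuo_sup_toQuo_eq_star (a b : L) :
    toQuo a ⊔ toQuo b = toQuo (CubicAlgebra.star a b) :=
  isLUB_pair.unique (isLUB_toQuo_star a b)

theorem toQuo_inf_toQuo_of_isCaret (h : IsCaret a b c) : toQuo a ⊓ toQuo b = toQuo c :=
  isGLB_pair.unique (isGLB_toQuo_of_isCaret h)

theorem toQuo_inf_toQuo (hm : IsGLB {a, b} m) : toQuo a ⊓ toQuo b = toQuo m :=
  isGLB_pair.unique (isGLB_toQuo hm)

/-- Residuation determines the implication by the order alone, hence independently of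
representatives. -/
theorem le_toQuo_arrow_iff (ha : p ≤ a) (hb : p ≤ b) (γ : Quo L) :
    γ ≤ toQuo (arrow a b) ↔ γ ⊓ toQuo a ≤ toQuo b := by
  obtain ⟨g, rfl⟩ := toQuo_surjective γ
  obtain ⟨d, q, hgd, hqd, hqp⟩ := exists_simeq_le g p
  obtain ⟨m, hm, hqm⟩ := exists_isGLB hqd (hqp.trans ha)
  have hqb := hqp.trans hb
  rw [toQuo_eq_iff.2 hgd, toQuo_inf_toQuo hm, toQuo_le_toQuo, toQuo_le_toQuo]
  constructor
  · exact fun h => below_of_le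
      ((le_arrow_iff_of_isGLB hm).1 (h.le hqd (hqb.trans (le_arrow a b))))
  · exact fun h => below_of_le ((le_arrow_iff_of_isGLB hm).2 (h.le hqm hqb))

theorem exists_toQuo_toQuo (α β : Quo L) :
    ∃ a b p : L, toQuo a = α ∧ toQuo b = β ∧ p ≤ a ∧ p ≤ b := by
  obtain ⟨a, rfl⟩ := toQuo_surjective α
  obtain ⟨b, rfl⟩ := toQuo_surjective β
  obtain ⟨d, q, had, hqd, hqb⟩ := exists_simeq_le a b
  exact ⟨d, b, q, (toQuo_eq_iff.2 had).symm, rfl, hqd, hqb⟩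

theorem le_toQuo_imp_iff (a b : L) (γ : Quo L) : γ ≤ toQuo (imp a b) ↔ γ ⊓ toQuo a ≤ toQuo b := by
  obtain ⟨c, hc⟩ := exists_isCaret b a
  rw [IsCaret, sup_comm] at hc
  have := le_toQuo_arrow_iff (hc.1 (Set.mem_insert_of_mem b rfl)) (hc.1 (Set.mem_insert b _)) γ
  rwa [toQuo_delta_sup'] at this

noncomputable instance : HImp (Quo L) where
  himp α β := toQuo (imp (toQuo_surjective α).choose (toQuo_surjective β).choose)

theorem le_himp_iff (α β γ : Quo L) : γ ≤ α ⇨ β ↔ γ ⊓ α ≤ β := by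
  have := le_toQuo_imp_iff (toQuo_surjective α).choose (toQuo_surjective β).choose γ
  rwa [(toQuo_surjective α).choose_spec, (toQuo_surjective β).choose_spec] at this

theorem toQuo_himp_toQuo_of_le (ha : p ≤ a) (hb : p ≤ b) : toQuo a ⇨ toQuo b = toQuo (arrow a b) :=
  eq_of_forall_le_iff fun γ => by rw [le_himp_iff, le_toQuo_arrow_iff ha hb]

theorem toQuo_himp_toQuo (a b : L) : toQuo a ⇨ toQuo b = toQuo (imp a b) :=
  eq_of_forall_le_iff fun γ => by rw [le_himp_iff, le_toQuo_imp_iff]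

noncomputable instance quoImplicationLattice : ImplicationLattice (Quo L) where
  himp_contraction α β := by
    obtain ⟨a, b, p, rfl, rfl, ha, hb⟩ := exists_toQuo_toQuo α β
    rw [toQuo_himp_toQuo_of_le ha hb, toQuo_himp_toQuo_of_le (hb.trans (le_arrow a b)) ha,
      arrow_contraction]
  himp_himp_eq_sup α β := by
    obtain ⟨a, b, p, rfl, rfl, ha, hb⟩ := exists_toQuo_toQuo α β
    rw [toQuo_himp_toQuo_of_le ha hb, toQuo_himp_toQuo_of_le (hb.trans (le_arrow a b)) hb,
      arrow_arrow_eq_sup, toQuo_sup_toQuo ha hb]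
  himp_exchange α β γ := eq_of_forall_le_iff fun δ => by
    rw [le_himp_iff, le_himp_iff, le_himp_iff, le_himp_iff, inf_right_comm]

end MRAlgebra

theorem mainTheorem4 (L : Type*) [MRAlgebra L] :
    ∃ h : Equivalence (CubicAlgebra.Simeq : L → L → Prop),
    ∃ _ : ImplicationLattice (CubicAlgebra.Collapse h),
      CubicAlgebra.cls h ⊤ = ⊤ ∧
      (∀ a b : L, CubicAlgebra.cls h a ⊔ CubicAlgebra.cls h b =
        CubicAlgebra.cls h (CubicAlgebra.star a b)) ∧
      (∀ a b : L, CubicAlgebra.cls h a ⇨ CubicAlgebra.cls h b =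
        CubicAlgebra.cls h (CubicAlgebra.imp a b)) ∧
      (∀ a b : L, ∃ c : L, CubicAlgebra.IsCaret a b c ∧
        CubicAlgebra.cls h a ⊓ CubicAlgebra.cls h b = CubicAlgebra.cls h c) := by
  refine ⟨CubicAlgebra.simeq_equivalence, MRAlgebra.quoImplicationLattice, rfl,
    MRAlgebra.toQuo_sup_toQuo_eq_star, MRAlgebra.toQuo_himp_toQuo, fun a b => ?_⟩
  obtain ⟨c, hc⟩ := MRAlgebra.exists_isCaret a b
  exact ⟨c, hc, MRAlgebra.toQuo_inf_toQuo_of_isCaret hc⟩
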